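/- Let $d\ge 0$ and $N\ge 2$ be integers and let $\phi:(0,+\infty)\to[0,+\infty)$ be continuous and strictly decreasing with $\lim_{t\to0^+}\phi(t)=+\infty$; put $\phi(0)=+\infty$. For $\mathbf x=(x_1,\dots,x_N)\in(\mathbb R^d)^N$ and $\alpha>0$ let $$c(\mathbf x)=\sum_{1\le i<j\le N}\phi(|x_i-x_j|)\in[0,+\infty],\qquad c_\alpha(\mathbf x)=\sum_{1\le i<j\le N}\min\{\phi(|x_i-x_j|),\phi(\alpha)\}.$$ Let $\rho$ be a Borel probability measure on $\mathbb R^d$, let $\Pi(\rho)$ be the set of Borel probability measures on $(\mathbb R^d)^N$ all of whose $N$ marginals are $\rho$, and let $$C(\rho)=\min_{P\in\Pi(\rho)}\int c\,dP .$$ For a cost $k\in\{c,c_\alpha\}$, a Kantorovich potential for $k$ is a maximizer of $u\mapsto N\int u\,d\rho$ among the $\rho$-integrable functions $u:\mathbb R^d\to\mathbb R$ such that $u(x_1)+\dots+u(x_N)\le k(x_1,\dots,x_N)$ for all $x_1,\dots,x_N\in\mathbb R^d$. Let $\mu_\rho(r)=\sup_{x\in\mathbb R^d}\rho(B(x,r))$,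 where $B(x,r)$ is the open ball, and assume $$\textbf{(A)}\qquad \lim_{r\to0^+}\mu_\rho(r)<\frac1{N(N-1)^2}.$$ Then the minimum defining $C(\rho)$ is attained, and $$C(\rho)=\max\Big\{N\int u\,d\rho\ :\ u:\mathbb R^d\to\mathbb R\ \ \rho\text{-integrable},\ u(x_1)+\dots+u(x_N)\le c(x_1,\dots,x_N)\ \text{ for all }x_1,\dots,x_N\in\mathbb R^d\Big\},$$ where the maximum is attained (in particular $C(\rho)<+\infty$). Moreover, if $\beta>0$ satisfies $\mu_\rho(\beta)<\frac1{N(N-1)^2}$ and $0<\alpha\le\phi^{-1}\big(\frac{N^2(N-1)}2\phi(\beta)\big)$, then every Kantorovich potential for $c_\alpha$ is also a Kantorovich potential for $c$. -/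

import Mathlib

open MeasureTheory Filter Set
open scoped ENNReal Topology

noncomputable section

namespace RepulsiveOT

/-- `ℝ^d` with its Euclidean norm. -/
abbrev Space (d : ℕ) : Type := EuclideanSpace ℝ (Fin d)

/-- The standing assumptions on the radial profile `φ : (0,∞) → [0,∞)`: only the values on `(0,∞)`
are constrained, and only these are used below. -/
structure IsRepulsive (φ : ℝ → ℝ) : Prop where
  continuousOn : ContinuousOn φ (Ioi 0)
  nonneg : ∀ t, 0 < t → 0 ≤ φ t
  tendsto_zero : Tendsto φ (𝓝[>] 0) atTop
  strictAntiOn : StrictAntiOn φ (Ioi 0)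

/-- `φ` as a function on `[0,∞)` with values in `[0,∞]`, with `φ(0) = lim_{t → 0+} φ(t) = +∞`. -/
def extend (φ : ℝ → ℝ) (t : ℝ) : ℝ≥0∞ :=
  if 0 < t then ENNReal.ofReal (φ t) else ⊤

/-- The truncation `φ_α(t) = min {φ(t), φ(α)}`. -/
def truncate (φ : ℝ → ℝ) (α : ℝ) (t : ℝ) : ℝ≥0∞ :=
  min (extend φ t) (ENNReal.ofReal (φ α))

/-- `∑_{i < j} ψ(|x_i - x_j|)`. -/
def pairCost {d N : ℕ} (ψ : ℝ → ℝ≥0∞) (x : Fin N → Space d) : ℝ≥0∞ :=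
  ∑ i : Fin N, ∑ j ∈ Finset.Ioi i, ψ ‖x i - x j‖

/-- The repulsive cost `c`; it is `+∞` where two of the points coincide. -/
def cost {d N : ℕ} (φ : ℝ → ℝ) : (Fin N → Space d) → ℝ≥0∞ :=
  pairCost (extend φ)

/-- The truncated cost `c_α`. -/
def truncatedCost {d N : ℕ} (φ : ℝ → ℝ) (α : ℝ) : (Fin N → Space d) → ℝ≥0∞ :=
  pairCost (truncate φ α)

/-- The set `Π(ρ)` of transport plans: probabilities on `(ℝ^d)^N` all of whose `N` marginals
are `ρ`. -/
def plans {d : ℕ} (N : ℕ) (ρ : Measure (Space d)) : Set (Measure (Fin N → Space d)) :=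
  {P | IsProbabilityMeasure P ∧ ∀ i, P.map (fun x => x i) = ρ}

/-- The optimal transport cost for the cost function `k`: the infimum of `∫ k dP` over `Π(ρ)`. -/
def transportCost {d N : ℕ} (k : (Fin N → Space d) → ℝ≥0∞) (ρ : Measure (Space d)) : ℝ≥0∞ :=
  ⨅ P ∈ plans N ρ, ∫⁻ x, k x ∂P

/-- The competitors of the dual problem: the `ρ`-integrable functions `u` with
`u(x_1) + ⋯ + u(x_N) ≤ k(x_1, …, x_N)` everywhere. -/
def dualAdmissible {d N : ℕ} (k : (Fin N → Space d) → ℝ≥0∞) (ρ : Measure (Space d)) :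
    Set (Space d → ℝ) :=
  {u | Integrable u ρ ∧
    ∀ x : Fin N → Space d, ((∑ i, u (x i) : ℝ) : EReal) ≤ ((k x : ℝ≥0∞) : EReal)}

/-- The dual functional `N ∫ u dρ`. -/
def dualValue {d : ℕ} (N : ℕ) (ρ : Measure (Space d)) (u : Space d → ℝ) : ℝ :=
  (N : ℝ) * ∫ x, u x ∂ρ

/-- Kantorovich potentials for the cost function `k`: maximizers of the dual problem. -/
def IsKantorovichPotential {d N : ℕ} (k : (Fin N → Space d) → ℝ≥0∞) (ρ : Measure (Space d))
    (u : Space d → ℝ) : Prop :=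
  u ∈ dualAdmissible k ρ ∧ IsMaxOn (dualValue N ρ) (dualAdmissible k ρ) u

/-- The measure of concentration `μ_ρ(r) = sup_x ρ(B(x,r))`. -/
def concentration {d : ℕ} (ρ : Measure (Space d)) (r : ℝ) : ℝ≥0∞ :=
  ⨆ x : Space d, ρ (Metric.ball x r)

/-- The threshold `1 / (N (N-1)^2)`. -/
def threshold (N : ℕ) : ℝ≥0∞ :=
  ENNReal.ofReal (1 / ((N : ℝ) * ((N : ℝ) - 1) ^ 2))

/-- Assumption (A), small concentration with respect to `N`:
`lim_{r → 0+} μ_ρ(r) < 1 / (N (N-1)^2)`. -/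
def SmallConcentration {d : ℕ} (N : ℕ) (ρ : Measure (Space d)) : Prop :=
  ∃ l : ℝ≥0∞, Tendsto (concentration ρ) (𝓝[>] 0) (𝓝 l) ∧ l < threshold N

/-- The inverse of `φ : (0,∞) → φ((0,∞))`. -/
def inverse (φ : ℝ → ℝ) : ℝ → ℝ :=
  Function.invFunOn φ (Ioi 0)

end RepulsiveOT

end

open RepulsiveOT

/-! The truncated cost $c_\alpha$ is bounded and uniformly continuous, so duality holds for it with
attainment on both sides (`exists_plan_potential`). For small $\alpha$ the optimal plan does not see
the truncation.

Equality of the two values puts the plan $P$ on contact tuples of the potential $u$, those with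
$\sum u(x_i)=c_\alpha(x)$. A contact tuple with two points closer than $\alpha$ costs at least
$\phi(\alpha)$. Small concentration supplies $N-1$ further contact tuples such that points of
different index in different tuples are $\beta$ apart. Exchanging coordinates cyclically among the
$N$ tuples preserves the total of $u$, but the new tuples are $\beta$-separated and cost together at
most $\frac{N^2(N-1)}2\phi(\beta)\le\phi(\alpha)$, strictly less than the old ones: a contradiction
(`separated_of_contact`). Hence $c=c_\alpha$ holds $P$-almost everywhere. As $u$ is admissible for
$c\ge c_\alpha$, weak duality makes $P$ and $u$ optimal for $c$ (`exists_plan_potential_cost`).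

For bounded costs, Hahn–Banach produces a positive functional with the right marginals; these make
it tight, hence a measure (`exists_plan_duality`). Maximal admissible functions inherit bounds and a
modulus of continuity from the cost, and compactness gives a dual maximizer. -/

noncomputable section

open scoped BoundedContinuousFunction CompactlySupported

namespace RepulsiveOT

/-! ### Tight positive functionals and the Riesz representation -/

/-- The radial cutoff equal to `1` up to `n` and to `0` from `n + 1` on. -/
def cutoff (n : ℕ) (t : ℝ) : ℝ := max 0 (min 1 (n + 1 - t))

theorem cutoff_nonneg (n : ℕ) (t : ℝ) : 0 ≤ cutoff n t := le_max_left _ _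

theorem cutoff_le_one (n : ℕ) (t : ℝ) : cutoff n t ≤ 1 :=
  max_le zero_le_one (min_le_left _ _)

theorem cutoff_of_le {n : ℕ} {t : ℝ} (h : t ≤ n) : cutoff n t = 1 := by
  rw [cutoff, min_eq_left (by linarith), max_eq_right zero_le_one]

theorem cutoff_of_ge {n : ℕ} {t : ℝ} (h : n + 1 ≤ t) : cutoff n t = 0 :=
  max_eq_left ((min_le_right _ _).trans (by linarith))

theorem continuous_cutoff (n : ℕ) : Continuous (cutoff n) := by
  unfold cutoff; fun_prop

theorem tendsto_cutoff (t : ℝ) : Tendsto (fun n => cutoff n t) atTop (𝓝 1) := by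
  obtain ⟨m, hm⟩ := exists_nat_ge t
  refine tendsto_const_nhds.congr' ?_
  filter_upwards [eventually_ge_atTop m] with n hn
  exact (cutoff_of_le (hm.trans (by exact_mod_cast hn))).symm

section Metric

variable {Y : Type*} [MetricSpace Y]

/-- The cutoff around a point, as a bounded continuous function. -/
def cutoffBCF (o : Y) (n : ℕ) : Y →ᵇ ℝ :=
  BoundedContinuousFunction.ofNormedAddCommGroup (fun y => cutoff n (dist y o))
    ((continuous_cutoff n).comp (continuous_id.dist continuous_const)) 1
    (fun y => by rw [Real.norm_of_nonneg (cutoff_nonneg _ _)]; exact cutoff_le_one _ _)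

@[simp] theorem cutoffBCF_apply (o : Y) (n : ℕ) (y : Y) :
    cutoffBCF o n y = cutoff n (dist y o) := rfl

/-- A compactly supported function as a bounded continuous function. -/
def boundedOfCompact (f : C_c(Y, ℝ)) : Y →ᵇ ℝ :=
  BoundedContinuousFunction.ofNormedAddCommGroup f f.continuous
    (f.hasCompactSupport.exists_bound_of_continuous f.continuous).choose
    (f.hasCompactSupport.exists_bound_of_continuous f.continuous).choose_spec

@[simp] theorem boundedOfCompact_apply (f : C_c(Y, ℝ)) (y : Y) : boundedOfCompact f y = f y := rfl

/-- The restriction of a functional on bounded continuous functions to the compactly supported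
ones. -/
def compactRestriction (L : (Y →ᵇ ℝ) →ₗ[ℝ] ℝ) (hL : ∀ f : Y →ᵇ ℝ, 0 ≤ f → 0 ≤ L f) :
    C_c(Y, ℝ) →ₚ[ℝ] ℝ :=
  PositiveLinearMap.mk₀
    { toFun := fun f => L (boundedOfCompact f)
      map_add' := fun f g => by rw [← map_add]; rfl
      map_smul' := fun c f => by rw [RingHom.id_apply, ← map_smul]; rfl }
    (fun f hf => hL _ hf)

@[simp] theorem compactRestriction_apply (L : (Y →ᵇ ℝ) →ₗ[ℝ] ℝ)
    (hL : ∀ f : Y →ᵇ ℝ, 0 ≤ f → 0 ≤ L f) (f : C_c(Y, ℝ)) :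
    compactRestriction L hL f = L (boundedOfCompact f) := rfl

/-- The product with a cutoff, as a compactly supported function. -/
def cutoffMul [ProperSpace Y] (o : Y) (n : ℕ) (f : Y →ᵇ ℝ) : C_c(Y, ℝ) where
  toFun := fun y => f y * cutoff n (dist y o)
  continuous_toFun := f.continuous.mul
    ((continuous_cutoff n).comp (continuous_id.dist continuous_const))
  hasCompactSupport' := by
    refine HasCompactSupport.intro (isCompact_closedBall o (n + 1)) fun y hy => ?_
    rw [Metric.mem_closedBall, not_le] at hy
    rw [cutoff_of_ge hy.le, mul_zero]

@[simp] theorem cutoffMul_apply [ProperSpace Y] (o : Y) (n : ℕ) (f : Y →ᵇ ℝ) (y : Y) :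
    cutoffMul o n f y = f y * cutoff n (dist y o) := rfl

variable [MeasurableSpace Y] [BorelSpace Y]

theorem tendsto_integral_cutoff (μ : Measure Y) [IsFiniteMeasure μ] (o : Y) (f : Y →ᵇ ℝ) :
    Tendsto (fun n => ∫ y, f y * cutoff n (dist y o) ∂μ) atTop (𝓝 (∫ y, f y ∂μ)) := by
  refine tendsto_integral_of_dominated_convergence (fun _ => ‖f‖) (fun n => ?_)
    (integrable_const _) (fun n => ?_) ?_
  · exact (f.continuous.mul ((continuous_cutoff n).comp
      (continuous_id.dist continuous_const))).aestronglyMeasurable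
  · refine Eventually.of_forall fun y => ?_
    rw [norm_mul, Real.norm_of_nonneg (cutoff_nonneg _ _)]
    exact (mul_le_of_le_one_right (norm_nonneg _) (cutoff_le_one _ _)).trans (f.norm_coe_le_norm y)
  · refine Eventually.of_forall fun y => ?_
    simpa using (tendsto_cutoff (dist y o)).const_mul (f y)

/-- A tight positive normalized functional on bounded continuous functions is the integral against
a probability measure. -/
theorem exists_measure_of_tight [ProperSpace Y] (o : Y) (L : (Y →ᵇ ℝ) →ₗ[ℝ] ℝ)
    (hL : ∀ f : Y →ᵇ ℝ, 0 ≤ f → 0 ≤ L f) (hone : L 1 = 1)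
    (htight : Tendsto (fun n => L (1 - cutoffBCF o n)) atTop (𝓝 0)) :
    ∃ P : Measure Y, IsProbabilityMeasure P ∧ ∀ f : Y →ᵇ ℝ, ∫ y, f y ∂P = L f := by
  have hmono : ∀ f g : Y →ᵇ ℝ, f ≤ g → L f ≤ L g := fun f g h => by
    have := hL (g - f) (sub_nonneg.2 h)
    rw [map_sub] at this
    linarith
  set Λ := compactRestriction L hL with hΛ
  set P := RealRMK.rieszMeasure Λ with hP
  have hball : ∀ n : ℕ, P (Metric.closedBall o n) ≤ 1 := fun n => by
    refine (RealRMK.rieszMeasure_le_of_eq_one Λ (f := cutoffMul o n 1) (fun y => ?_)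
      (isCompact_closedBall o n) (fun y hy => ?_)).trans ?_
    · simpa using cutoff_nonneg _ _
    · simpa using cutoff_of_le (Metric.mem_closedBall.1 hy)
    · rw [← ENNReal.ofReal_one]
      refine ENNReal.ofReal_le_ofReal ?_
      rw [hΛ, compactRestriction_apply, ← hone]
      exact hmono _ _ fun y => by simpa using cutoff_le_one _ _
  have huniv : P univ ≤ 1 := by
    rw [← Metric.iUnion_closedBall_nat o, Monotone.measure_iUnion]
    · exact iSup_le hball
    · intro m n h
      exact Metric.closedBall_subset_closedBall (by exact_mod_cast h)
  have : IsFiniteMeasure P := ⟨huniv.trans_lt ENNReal.one_lt_top⟩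
  have hint : ∀ f : Y →ᵇ ℝ, ∫ y, f y ∂P = L f := fun f => by
    refine tendsto_nhds_unique (tendsto_integral_cutoff P o f) ?_
    -- The Riesz measure represents `L` only on compactly supported functions. The error is
    -- controlled by positivity, through $|f-f\chi_n|\le\|f\|(1-\chi_n)$ and tightness.
    have heq : ∀ n, ∫ y, f y * cutoff n (dist y o) ∂P = L (f * cutoffBCF o n) := fun n =>
      RealRMK.integral_rieszMeasure Λ (cutoffMul o n f)
    simp_rw [heq]
    rw [tendsto_iff_dist_tendsto_zero]
    have h0 : Tendsto (fun n => ‖f‖ * L (1 - cutoffBCF o n)) atTop (𝓝 0) := by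
      simpa using htight.const_mul ‖f‖
    refine squeeze_zero (fun _ => dist_nonneg) (fun n => ?_) h0
    have hb : ∀ y, |f y| * (1 - cutoff n (dist y o)) ≤ ‖f‖ * (1 - cutoff n (dist y o)) := fun y =>
      mul_le_mul_of_nonneg_right (f.norm_coe_le_norm y) (sub_nonneg.2 (cutoff_le_one _ _))
    have hc : ∀ y, 0 ≤ 1 - cutoff n (dist y o) := fun y => sub_nonneg.2 (cutoff_le_one _ _)
    have h1 : L (f - f * cutoffBCF o n) ≤ L (‖f‖ • (1 - cutoffBCF o n)) := hmono _ _ fun y => by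
      have := mul_le_mul_of_nonneg_right (le_abs_self (f y)) (hc y)
      have := hb y
      simp
      linarith
    have h2 : L (f * cutoffBCF o n - f) ≤ L (‖f‖ • (1 - cutoffBCF o n)) := hmono _ _ fun y => by
      have := mul_le_mul_of_nonneg_right (neg_le_abs (f y)) (hc y)
      have := hb y
      simp
      linarith
    rw [map_sub, map_smul, smul_eq_mul] at h1 h2
    rw [Real.dist_eq, abs_le]
    constructor <;> linarith
  refine ⟨P, ⟨?_⟩, hint⟩
  have h1 := hint 1
  rw [hone] at h1
  simp only [BoundedContinuousFunction.coe_one, Pi.one_apply, integral_const, smul_eq_mul,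
    mul_one] at h1
  rw [← ENNReal.toReal_eq_one_iff]
  exact h1

end Metric

/-! ### Multimarginal duality by Hahn–Banach -/

section Product

variable {ι X : Type*} [MetricSpace X]

/-- The bounded continuous function `x ↦ u (x i)`. -/
def coordComp (i : ι) (u : X →ᵇ ℝ) : (ι → X) →ᵇ ℝ :=
  u.compContinuous ⟨fun x => x i, continuous_apply i⟩

@[simp] theorem coordComp_apply (i : ι) (u : X →ᵇ ℝ) (x : ι → X) : coordComp i u x = u (x i) := rfl

variable [Fintype ι]

/-- The sup distance is realized by one coordinate, whose term alone suffices. This reduces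
tightness on the product to tightness of the marginals. -/
theorem one_sub_cutoff_le_sum [Nonempty ι] (o : X) (n : ℕ) (x : ι → X) :
    1 - cutoff n (dist x (fun _ => o)) ≤ ∑ i, (1 - cutoff n (dist (x i) o)) := by
  obtain ⟨i, -, hi⟩ := Finset.exists_mem_eq_sup' (Finset.univ_nonempty (α := ι))
    (fun i => dist (x i) o)
  have hd : dist x (fun _ => o) ≤ dist (x i) o :=
    (dist_pi_le_iff dist_nonneg).2 fun j => hi ▸ Finset.le_sup' (fun i => dist (x i) o)
      (Finset.mem_univ j)
  have hd' : dist x (fun _ => o) = dist (x i) o := le_antisymm hd (dist_le_pi_dist x (fun _ => o) i)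
  rw [hd']
  exact Finset.single_le_sum (f := fun i => 1 - cutoff n (dist (x i) o))
    (fun j _ => sub_nonneg.2 (cutoff_le_one _ _)) (Finset.mem_univ i)

variable [MeasurableSpace X]

/-- A positive functional on the bounded continuous functions of a product which integrates the
functions of one coordinate against `ρ` is the integral against a measure with marginals `ρ`. -/
theorem exists_plan_of_functional [ProperSpace X] [BorelSpace X] [Nonempty ι] (ρ : Measure X)
    [IsProbabilityMeasure ρ]
    (L : ((ι → X) →ᵇ ℝ) →ₗ[ℝ] ℝ) (hL : ∀ f, 0 ≤ f → 0 ≤ L f)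
    (hmarg : ∀ i u, L (coordComp i u) = ∫ x, u x ∂ρ) :
    ∃ P : Measure (ι → X), IsProbabilityMeasure P ∧ (∀ i, P.map (fun x => x i) = ρ) ∧
      ∀ f : (ι → X) →ᵇ ℝ, ∫ x, f x ∂P = L f := by
  obtain ⟨o⟩ : Nonempty X := ρ.nonempty_of_neZero
  obtain ⟨i₀⟩ := ‹Nonempty ι›
  have : Nonempty ι := ⟨i₀⟩
  have hone : L 1 = 1 := by
    have h : coordComp i₀ (1 : X →ᵇ ℝ) = 1 := rfl
    rw [← h, hmarg i₀]
    simp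
  have hlim : Tendsto (fun n => ∑ i : ι, L (coordComp i (1 - cutoffBCF o n))) atTop (𝓝 0) := by
    have h1 : Tendsto (fun n => ∫ x, (1 - cutoffBCF o n : X →ᵇ ℝ) x ∂ρ) atTop (𝓝 0) := by
      have h := (tendsto_integral_cutoff ρ o 1).const_sub 1
      simp only [BoundedContinuousFunction.coe_one, Pi.one_apply, one_mul, integral_const,
        probReal_univ, smul_eq_mul, mul_one, sub_self] at h
      refine h.congr fun n => ?_
      simp only [BoundedContinuousFunction.coe_sub, Pi.sub_apply]
      rw [integral_sub ((1 : X →ᵇ ℝ).integrable ρ) ((cutoffBCF o n).integrable ρ)]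
      simp
    simp_rw [hmarg]
    simpa using tendsto_finsetSum (Finset.univ : Finset ι) (fun i _ => h1)
  have htight : Tendsto (fun n => L (1 - cutoffBCF (fun _ : ι => o) n)) atTop (𝓝 0) := by
    refine squeeze_zero (fun n => hL _ fun x => ?_) (fun n => ?_) hlim
    · simpa using cutoff_le_one _ _
    · rw [← map_sum]
      have h := hL (∑ i : ι, coordComp i (1 - cutoffBCF o n) - (1 - cutoffBCF (fun _ : ι => o) n))
        (fun x => by simpa using one_sub_cutoff_le_sum o n x)
      rw [map_sub] at h
      linarith
  obtain ⟨P, hP, hint⟩ := exists_measure_of_tight (fun _ : ι => o) L hL hone htight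
  refine ⟨P, hP, fun i => ?_, hint⟩
  have : IsProbabilityMeasure (P.map (fun x => x i)) :=
    Measure.isProbabilityMeasure_map (measurable_pi_apply i).aemeasurable
  refine ext_of_forall_integral_eq_of_IsFiniteMeasure fun u => ?_
  rw [integral_map (measurable_pi_apply i).aemeasurable u.continuous.aestronglyMeasurable,
    ← hmarg i, ← hint]
  rfl

/-- The values `∑ ∫ u_i dρ` over the families `u` of bounded continuous functions with
`∑ u_i (x_i) ≥ f x`. -/
def superValues (ρ : Measure X) (f : (ι → X) →ᵇ ℝ) : Set ℝ :=
  {a | ∃ u : ι → X →ᵇ ℝ, (∀ x : ι → X, f x ≤ ∑ i, u i (x i)) ∧ a = ∑ i, ∫ x, u i x ∂ρ}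

/-- Each `u i` is at most its mean at some point, and these points, chosen independently, form a
tuple at which to test the constraint. -/
theorem superValues_bound [BorelSpace X] (ρ : Measure X) [IsProbabilityMeasure ρ]
    {f : (ι → X) →ᵇ ℝ} {m a : ℝ}
    (hm : ∀ x, m ≤ f x) (ha : a ∈ superValues ρ f) : m ≤ a := by
  obtain ⟨u, hu, rfl⟩ := ha
  choose x hx using fun i => exists_le_integral ((u i).integrable ρ)
  exact (hm x).trans ((hu x).trans (Finset.sum_le_sum fun i _ => hx i))

theorem bddBelow_superValues [BorelSpace X] (ρ : Measure X) [IsProbabilityMeasure ρ]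
    (f : (ι → X) →ᵇ ℝ) :
    BddBelow (superValues ρ f) :=
  ⟨-‖f‖, fun _ => superValues_bound ρ fun x => f.neg_norm_le_apply x⟩

theorem superValues_nonempty [Nonempty ι] (ρ : Measure X) (f : (ι → X) →ᵇ ℝ) :
    (superValues ρ f).Nonempty := by
  refine ⟨_, fun _ => BoundedContinuousFunction.const X ‖f‖, fun x => ?_, rfl⟩
  obtain ⟨i⟩ := ‹Nonempty ι›
  refine (f.apply_le_norm x).trans ?_
  exact Finset.single_le_sum (f := fun _ : ι => ‖f‖) (fun _ _ => norm_nonneg f) (Finset.mem_univ i)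

theorem mem_superValues_add [BorelSpace X] {ρ : Measure X} [IsProbabilityMeasure ρ]
    {f g : (ι → X) →ᵇ ℝ} {a b : ℝ}
    (ha : a ∈ superValues ρ f) (hb : b ∈ superValues ρ g) : a + b ∈ superValues ρ (f + g) := by
  obtain ⟨u, hu, rfl⟩ := ha
  obtain ⟨v, hv, rfl⟩ := hb
  refine ⟨fun i => u i + v i, fun x => ?_, ?_⟩
  · simpa [Finset.sum_add_distrib] using add_le_add (hu x) (hv x)
  · rw [← Finset.sum_add_distrib]
    exact Finset.sum_congr rfl fun i _ =>
      (integral_add ((u i).integrable ρ) ((v i).integrable ρ)).symm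

theorem mem_superValues_smul {ρ : Measure X} {f : (ι → X) →ᵇ ℝ} {a c : ℝ} (hc : 0 ≤ c)
    (ha : a ∈ superValues ρ f) : c * a ∈ superValues ρ (c • f) := by
  obtain ⟨u, hu, rfl⟩ := ha
  refine ⟨fun i => c • u i, fun x => ?_, ?_⟩
  · simpa [Finset.mul_sum] using mul_le_mul_of_nonneg_left (hu x) hc
  · rw [Finset.mul_sum]
    exact Finset.sum_congr rfl fun i _ => by simp [integral_const_mul]

/-- The infimum of `∑ ∫ u_i dρ` over the families with `∑ u_i (x_i) ≥ f x`. -/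
def superValue (ρ : Measure X) (f : (ι → X) →ᵇ ℝ) : ℝ := sInf (superValues ρ f)

theorem superValue_le [BorelSpace X] {ρ : Measure X} [IsProbabilityMeasure ρ]
    {f : (ι → X) →ᵇ ℝ} {a : ℝ}
    (ha : a ∈ superValues ρ f) : superValue ρ f ≤ a :=
  csInf_le (bddBelow_superValues ρ f) ha

theorem superValue_smul_le [BorelSpace X] [Nonempty ι] (ρ : Measure X)
    [IsProbabilityMeasure ρ] {c : ℝ} (hc : 0 < c) (f : (ι → X) →ᵇ ℝ) : superValue ρ (c • f) ≤ c * superValue ρ f := by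
  rw [← div_le_iff₀' hc]
  refine le_csInf (superValues_nonempty ρ f) fun a ha => ?_
  rw [div_le_iff₀' hc]
  exact superValue_le (mem_superValues_smul hc.le ha)

theorem superValue_smul [BorelSpace X] [Nonempty ι] (ρ : Measure X) [IsProbabilityMeasure ρ] {c : ℝ}
    (hc : 0 < c) (f : (ι → X) →ᵇ ℝ) : superValue ρ (c • f) = c * superValue ρ f := by
  refine le_antisymm (superValue_smul_le ρ hc f) ?_
  have h := superValue_smul_le ρ (inv_pos.2 hc) (c • f)
  rw [smul_smul, inv_mul_cancel₀ hc.ne', one_smul] at h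
  rwa [← le_inv_mul_iff₀ hc]

theorem superValue_add_le [BorelSpace X] [Nonempty ι] (ρ : Measure X) [IsProbabilityMeasure ρ]
    (f g : (ι → X) →ᵇ ℝ) : superValue ρ (f + g) ≤ superValue ρ f + superValue ρ g := by
  rw [← sub_le_iff_le_add]
  refine le_csInf (superValues_nonempty ρ f) fun a ha => ?_
  rw [sub_le_iff_le_add, ← sub_le_iff_le_add']
  refine le_csInf (superValues_nonempty ρ g) fun b hb => ?_
  rw [sub_le_iff_le_add']
  exact superValue_le (mem_superValues_add ha hb)

theorem superValue_coordComp_le [BorelSpace X] [DecidableEq ι] (ρ : Measure X)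
    [IsProbabilityMeasure ρ] (i : ι)
    (u : X →ᵇ ℝ) : superValue ρ (coordComp i u) ≤ ∫ x, u x ∂ρ := by
  refine superValue_le ⟨Pi.single i u, fun x => ?_, ?_⟩
  · rw [Finset.sum_eq_single i (fun j _ hj => by simp [hj]) (by simp)]
    simp
  · rw [Finset.sum_eq_single i (fun j _ hj => by simp [hj]) (by simp)]
    simp

/-- Multimarginal Kantorovich duality for a bounded continuous cost, without attainment in the dual
problem. -/
theorem exists_plan_duality [ProperSpace X] [BorelSpace X] [Nonempty ι] (ρ : Measure X)
    [IsProbabilityMeasure ρ]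
    (k : (ι → X) →ᵇ ℝ) :
    ∃ P : Measure (ι → X), IsProbabilityMeasure P ∧ (∀ i, P.map (fun x => x i) = ρ) ∧
      ∀ ε > 0, ∃ u : ι → X →ᵇ ℝ, (∀ x : ι → X, ∑ i, u i (x i) ≤ k x) ∧
        ∫ x, k x ∂P - ε < ∑ i, ∫ x, u i x ∂ρ := by
  classical
  have hzero : superValue ρ (0 : (ι → X) →ᵇ ℝ) = 0 := by
    have := superValue_smul ρ two_pos (0 : (ι → X) →ᵇ ℝ)
    rw [smul_zero] at this
    linarith
  have hneg : ∀ f : (ι → X) →ᵇ ℝ, -superValue ρ (-f) ≤ superValue ρ f := fun f => by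
    have := superValue_add_le ρ f (-f)
    rw [add_neg_cancel, hzero] at this
    linarith
  obtain ⟨L, hLk, hL⟩ : ∃ L : ((ι → X) →ᵇ ℝ) →ₗ[ℝ] ℝ,
      L (-k) = superValue ρ (-k) ∧ ∀ f, L f ≤ superValue ρ f := by
    -- The vector `-k` may vanish, so the value prescribed on its span must be consistent.
    have hk : ∀ c : ℝ, c • -k = 0 → c • superValue ρ (-k) = 0 := fun c hc => by
      rcases smul_eq_zero.1 hc with rfl | h
      · rw [zero_smul]
      · rw [h, hzero, smul_zero]
    obtain ⟨L, hLk, hL⟩ := exists_extension_of_le_sublinear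
      (LinearPMap.mkSpanSingleton' (-k) (superValue ρ (-k)) hk)
      (superValue ρ) (fun c hc f => superValue_smul ρ hc f) (superValue_add_le ρ) (by
        rintro ⟨f, hf⟩
        obtain ⟨c, rfl⟩ := Submodule.mem_span_singleton.1 hf
        rw [LinearPMap.mkSpanSingleton'_apply]
        rcases lt_trichotomy c 0 with hc | rfl | hc
        -- Homogeneity covers only positive multiples; negative ones use $0\le p(f)+p(-f)$ for the
        -- sublinear $p$.
        · have h := hneg (c • -k)
          have hs : -(c • -k) = (-c) • -k := (neg_smul c (-k)).symm
          rw [hs, superValue_smul ρ (neg_pos.2 hc)] at h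
          simp only [RingHom.id_apply, smul_eq_mul]
          linarith
        · simp [hzero]
        · exact (superValue_smul ρ hc (-k)).ge)
    exact ⟨L, (hLk ⟨-k, Submodule.mem_span_singleton_self _⟩).trans
      (LinearPMap.mkSpanSingleton'_apply_self _ _ hk _), hL⟩
  have hpos : ∀ f, 0 ≤ f → 0 ≤ L f := fun f hf => by
    have h := hL (-f)
    have h0 : superValue ρ (-f) ≤ 0 := by
      refine superValue_le ⟨0, fun x => ?_, by simp⟩
      simpa using hf x
    rw [map_neg] at h
    linarith
  -- The upper bound for both $u$ and $-u$ forces equality.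
  have hmarg : ∀ i u, L (coordComp i u) = ∫ x, u x ∂ρ := fun i u => by
    refine le_antisymm ((hL _).trans (superValue_coordComp_le ρ i u)) ?_
    have h := (hL _).trans (superValue_coordComp_le ρ i (-u))
    have h1 : coordComp i (-u) = -coordComp i u := rfl
    rw [h1, map_neg] at h
    simp only [BoundedContinuousFunction.coe_neg, Pi.neg_apply, integral_neg] at h
    linarith
  obtain ⟨P, hP, hPm, hint⟩ := exists_plan_of_functional ρ L hpos hmarg
  refine ⟨P, hP, hPm, fun ε hε => ?_⟩
  obtain ⟨a, ⟨u, hu, rfl⟩, ha⟩ := exists_lt_of_csInf_lt (superValues_nonempty ρ (-k))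
    (lt_add_of_pos_right (superValue ρ (-k)) hε)
  refine ⟨fun i => -u i, fun x => ?_, ?_⟩
  · have := hu x
    simp only [BoundedContinuousFunction.coe_neg, Pi.neg_apply, Finset.sum_neg_distrib] at this ⊢
    linarith
  · rw [hint]
    rw [← hLk, map_neg] at ha
    simp only [BoundedContinuousFunction.coe_neg, Pi.neg_apply, integral_neg,
      Finset.sum_neg_distrib]
    linarith

end Product

/-! ### Maximal admissible functions and their regularity -/

section Maximal

variable {ι X : Type*} [Fintype ι]

/-- The functions `u` with `∑ u (x_i) ≤ k x` everywhere. -/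
def subCost (k : (ι → X) → ℝ) : Set (X → ℝ) := {u | ∀ x : ι → X, ∑ i, u (x i) ≤ k x}

theorem card_mul_le_of_mem_subCost {k : (ι → X) → ℝ} {u : X → ℝ} (hu : u ∈ subCost k) (x : X) :
    Fintype.card ι * u x ≤ k (fun _ => x) := by
  simpa using hu (fun _ => x)

variable [Nonempty ι]

/-- Zorn applies because diagonal tuples bound a chain pointwise. The supremum is a limit along the
directed chain, so the constraint, a finite sum, passes to it. -/
theorem exists_maximal_subCost {k : (ι → X) → ℝ} {v : X → ℝ} (hv : v ∈ subCost k) :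
    ∃ u, v ≤ u ∧ Maximal (· ∈ subCost k) u := by
  refine zorn_le_nonempty₀ (subCost k) (fun c hc hchain y hy => ?_) v hv
  have hcard : (0 : ℝ) < Fintype.card ι := by exact_mod_cast Fintype.card_pos
  have hbdd : ∀ x, BddAbove (range fun w : c => (w : X → ℝ) x) := fun x => by
    refine ⟨k (fun _ => x) / Fintype.card ι, ?_⟩
    rintro _ ⟨w, rfl⟩
    exact (le_div_iff₀' hcard).2 (card_mul_le_of_mem_subCost (hc w.2) x)
  have : Nonempty c := ⟨⟨y, hy⟩⟩
  have : IsDirectedOrder c := ⟨fun a b => by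
    rcases hchain.total a.2 b.2 with h | h
    · exact ⟨b, h, le_rfl⟩
    · exact ⟨a, le_rfl, h⟩⟩
  refine ⟨fun x => ⨆ w : c, (w : X → ℝ) x, fun x => ?_, fun w hw x => ?_⟩
  · refine le_of_tendsto' (f := fun w : c => ∑ i, (w : X → ℝ) (x i))
      (tendsto_finsetSum _ fun i _ => tendsto_atTop_ciSup 
        (fun a b h => (show (a : X → ℝ) ≤ b from h) (x i)) (hbdd (x i)))
      fun w => hc w.2 x
  · exact le_ciSup (hbdd x) ⟨w, hw⟩

/-- Otherwise `u` could be raised at `x` alone by $\varepsilon/N$, with $N$ the number of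
coordinates: even if all of them equal `x`, the sum grows by at most $\varepsilon$. -/
theorem exists_almost_contact {k : (ι → X) → ℝ} {u : X → ℝ} (hu : Maximal (· ∈ subCost k) u)
    (x : X) {ε : ℝ} (hε : 0 < ε) : ∃ (z : ι → X) (i : ι), z i = x ∧ k z - ε < ∑ j, u (z j) := by
  classical
  by_contra! h
  have hcard : (0 : ℝ) < Fintype.card ι := by exact_mod_cast Fintype.card_pos
  have hε' : 0 < ε / Fintype.card ι := div_pos hε hcard
  set w : X → ℝ := Function.update u x (u x + ε / Fintype.card ι) with hw
  have hwle : ∀ y, w y ≤ u y + ε / Fintype.card ι := fun y => by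
    by_cases hy : y = x
    · subst hy; simp [hw]
    · simp [hw, hy, hε'.le]
  have huw : u ≤ w := fun y => by
    by_cases hy : y = x
    · subst hy; simp [hw, hε'.le]
    · simp [hw, hy]
  have hmem : w ∈ subCost k := fun z => by
    by_cases hz : ∃ i, z i = x
    · obtain ⟨i, hi⟩ := hz
      have h1 := h z i hi
      have h2 : ∑ j, w (z j) ≤ ∑ j, (u (z j) + ε / Fintype.card ι) :=
        Finset.sum_le_sum fun j _ => hwle (z j)
      rw [Finset.sum_add_distrib, Finset.sum_const, Finset.card_univ, nsmul_eq_mul,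
        mul_div_cancel₀ _ hcard.ne'] at h2
      linarith
    · push Not at hz
      have : ∀ j, w (z j) = u (z j) := fun j => by simp [hw, hz j]
      simp_rw [this]
      exact hu.prop z
  have hx := hu.le_of_ge hmem huw x
  simp only [hw, Function.update_self] at hx
  linarith

/-- Moving one coordinate of an almost contact tuple from `x` to `y` changes the cost by at most
`η`, and admissibility of the new tuple bounds `u y - u x`. -/
theorem maximal_subCost_sub_le [MetricSpace X] {k : (ι → X) → ℝ} {u : X → ℝ}
    (hu : Maximal (· ∈ subCost k) u) {δ η : ℝ}
    (hk : ∀ z z' : ι → X, dist z z' < δ → |k z - k z'| ≤ η) {x y : X} (hxy : dist x y < δ) :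
    |u x - u y| ≤ η := by
  classical
  have key : ∀ x y : X, dist x y < δ → u y - u x ≤ η := fun x y hxy => by
    refine le_of_forall_pos_le_add fun ε hε => ?_
    obtain ⟨z, i, rfl, hz⟩ := exists_almost_contact hu x hε
    have h1 := hu.prop (Function.update z i y)
    have h2 : dist (Function.update z i y) z < δ := by
      have hδ : 0 < δ := dist_nonneg.trans_lt hxy
      refine (dist_pi_lt_iff hδ).2 fun j => ?_
      by_cases hj : j = i
      · subst hj; simpa [dist_comm] using hxy
      · simpa [hj] using hδ
    have h3 := (abs_le.1 (hk _ _ h2)).2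
    have h4 : ∑ j, u (Function.update z i y j) = ∑ j, u (z j) + (u y - u (z i)) := by
      rw [← Finset.add_sum_erase _ _ (Finset.mem_univ i),
        ← Finset.add_sum_erase _ (fun j => u (z j)) (Finset.mem_univ i), Function.update_self,
        Finset.sum_congr rfl (g := fun j => u (z j)) fun j hj => by
          rw [Function.update_of_ne (Finset.ne_of_mem_erase hj)]]
      ring
    linarith
  rw [abs_le]
  have h1 := key x y hxy
  have h2 := key y x (by rwa [dist_comm])
  constructor <;> linarith

/-- Diagonal tuples give the upper bound; an almost contact tuple through `x`, whose other values
are bounded above, gives the lower one. -/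
theorem maximal_subCost_abs_le {k : (ι → X) → ℝ} {u : X → ℝ} (hu : Maximal (· ∈ subCost k) u)
    {M : ℝ} (hk0 : ∀ x, 0 ≤ k x) (hkM : ∀ x, k x ≤ M) (x : X) : |u x| ≤ Fintype.card ι * M := by
  classical
  have hcard : (1 : ℝ) ≤ Fintype.card ι := by exact_mod_cast Fintype.card_pos
  have hM : 0 ≤ M := (hk0 fun _ => x).trans (hkM _)
  have hle : ∀ y, u y ≤ M := fun y => by
    have h := (card_mul_le_of_mem_subCost hu.prop y).trans (hkM _)
    by_contra! hy
    nlinarith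
  rw [abs_le]
  refine ⟨?_, by nlinarith [hle x]⟩
  refine le_of_forall_pos_le_add fun ε hε => ?_
  obtain ⟨z, i, rfl, hz⟩ := exists_almost_contact hu x hε
  have h0 := hk0 z
  rw [← Finset.add_sum_erase _ _ (Finset.mem_univ i)] at hz
  have h1 : ∑ j ∈ Finset.univ.erase i, u (z j) ≤ ∑ j : ι, M :=
    (Finset.sum_le_sum fun j _ => hle (z j)).trans
      (Finset.sum_le_sum_of_subset_of_nonneg (Finset.erase_subset _ _) fun _ _ _ => hM)
  rw [Finset.sum_const, Finset.card_univ, nsmul_eq_mul] at h1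
  linarith

end Maximal

/-! ### Compactness and attainment in the dual problem -/

/-- A uniformly bounded, uniformly equicontinuous sequence on a separable space has a pointwise
convergent subsequence. -/
theorem exists_subseq_tendsto {X : Type*} [MetricSpace X] [TopologicalSpace.SeparableSpace X]
    [Nonempty X] (v : ℕ → X → ℝ) {B : ℝ} (hB : ∀ n x, |v n x| ≤ B)
    (heq : ∀ ε > 0, ∃ δ > 0, ∀ n x y, dist x y < δ → |v n x - v n y| ≤ ε) :
    ∃ (u : X → ℝ) (s : ℕ → ℕ), StrictMono s ∧
      ∀ x, Tendsto (fun n => v (s n) x) atTop (𝓝 (u x)) := by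
  set q := TopologicalSpace.denseSeq X
  have hcomp : IsCompact (univ.pi fun _ : ℕ => Icc (-B) B) :=
    isCompact_univ_pi fun _ => isCompact_Icc
  obtain ⟨a, -, s, hs, ha⟩ := hcomp.tendsto_subseq (x := fun n m => v n (q m))
    (fun n m _ => abs_le.1 (hB n (q m)))
  have hcauchy : ∀ x, CauchySeq fun n => v (s n) x := fun x => by
    rw [Metric.cauchySeq_iff]
    intro ε hε
    obtain ⟨δ, hδ, h⟩ := heq (ε / 4) (by positivity)
    obtain ⟨m, hm⟩ := (TopologicalSpace.denseRange_denseSeq X).exists_dist_lt x hδ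
    have hq : CauchySeq fun n => v (s n) (q m) := ((tendsto_pi_nhds.1 ha) m).cauchySeq
    obtain ⟨n₀, hn₀⟩ := Metric.cauchySeq_iff.1 hq (ε / 4) (by positivity)
    refine ⟨n₀, fun i hi j hj => ?_⟩
    have h1 := abs_le.1 (h (s i) x (q m) hm)
    have h2 := abs_le.1 (h (s j) x (q m) hm)
    have h3 := hn₀ i hi j hj
    rw [Real.dist_eq, abs_lt] at h3
    rw [Real.dist_eq, abs_lt]
    constructor <;> linarith
  choose u hu using fun x => cauchySeq_tendsto_of_complete (hcauchy x)
  exact ⟨u, s, hs, hu⟩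

/-- Averaging a family of functions lying below a symmetric cost. -/
theorem average_mem_subCost {N : ℕ} [NeZero N] {X : Type*} {k : (Fin N → X) → ℝ}
    (hsymm : ∀ (σ : Equiv.Perm (Fin N)) x, k (x ∘ σ) = k x) {u : Fin N → X → ℝ}
    (hu : ∀ x : Fin N → X, ∑ i, u i (x i) ≤ k x) :
    (fun y => (N : ℝ)⁻¹ * ∑ j, u j y) ∈ subCost k := by
  intro x
  have hN : (0 : ℝ) < N := by exact_mod_cast Nat.pos_of_neZero N
  rw [← Finset.mul_sum, inv_mul_le_iff₀ hN]
  -- With $i=j+m$, the double sum splits into $N$ cyclic shifts of `x`, all of the same cost.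
  calc ∑ i, ∑ j, u j (x i) = ∑ j, ∑ m, u j (x (j + m)) := by
        rw [Finset.sum_comm]
        exact Finset.sum_congr rfl fun j _ =>
          (Equiv.sum_comp (Equiv.addLeft j) fun i => u j (x i)).symm
    _ = ∑ m, ∑ j, u j (x (j + m)) := Finset.sum_comm
    _ ≤ ∑ _m : Fin N, k x := Finset.sum_le_sum fun m _ => by
        rw [← hsymm (Equiv.addRight m) x]
        exact hu (x ∘ Equiv.addRight m)
    _ = N * k x := by simp

/-- Multimarginal Kantorovich duality with attainment on both sides, for a bounded uniformly
continuous symmetric cost. -/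
theorem exists_plan_potential {N : ℕ} [NeZero N] {X : Type*} [MetricSpace X] [ProperSpace X]
    [MeasurableSpace X] [BorelSpace X] (ρ : Measure X) [IsProbabilityMeasure ρ]
    {k : (Fin N → X) → ℝ} {M : ℝ} (hk : UniformContinuous k) (hk0 : ∀ x, 0 ≤ k x)
    (hkM : ∀ x, k x ≤ M) (hsymm : ∀ (σ : Equiv.Perm (Fin N)) x, k (x ∘ σ) = k x) :
    ∃ P : Measure (Fin N → X), IsProbabilityMeasure P ∧ (∀ i, P.map (fun x => x i) = ρ) ∧
      ∃ u ∈ subCost k, Integrable u ρ ∧ ∫ x, k x ∂P ≤ N * ∫ x, u x ∂ρ := by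
  have : Nonempty X := ρ.nonempty_of_neZero
  have hN : (0 : ℝ) < N := by exact_mod_cast Nat.pos_of_neZero N
  let kb : (Fin N → X) →ᵇ ℝ := BoundedContinuousFunction.ofNormedAddCommGroup k hk.continuous M
    fun x => by rw [Real.norm_of_nonneg (hk0 x)]; exact hkM x
  obtain ⟨P, hP, hPm, hdual⟩ := exists_plan_duality ρ kb
  refine ⟨P, hP, hPm, ?_⟩
  set I := ∫ x, k x ∂P with hI
  have hmod : ∀ ε > 0, ∃ δ > 0, ∀ w : X → ℝ, Maximal (· ∈ subCost k) w → ∀ x y, dist x y < δ →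
      |w x - w y| ≤ ε := fun ε hε => by
    obtain ⟨δ, hδ, h⟩ := Metric.uniformContinuous_iff.1 hk ε hε
    exact ⟨δ, hδ, fun w hw x y hxy => maximal_subCost_sub_le hw
      (fun z z' hz => (h hz).le) hxy⟩
  have hcont : ∀ w : X → ℝ, Maximal (· ∈ subCost k) w → Continuous w := fun w hw => by
    refine Metric.continuous_iff.2 fun x ε hε => ?_
    obtain ⟨δ, hδ, h⟩ := hmod (ε / 2) (by positivity)
    exact ⟨δ, hδ, fun y hy => (h w hw y x hy).trans_lt (by linarith)⟩
  have hintM : ∀ w : X → ℝ, Maximal (· ∈ subCost k) w → Integrable w ρ := fun w hw =>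
    Integrable.of_bound (hcont w hw).aestronglyMeasurable (Fintype.card (Fin N) * M)
      (Eventually.of_forall fun x => maximal_subCost_abs_le hw hk0 hkM x)
  have hstep : ∀ n : ℕ, ∃ w : X → ℝ, Maximal (· ∈ subCost k) w ∧
      I - 1 / ((n : ℝ) + 1) ≤ N * ∫ x, w x ∂ρ := fun n => by
    obtain ⟨u, hu, hlt⟩ := hdual (1 / ((n : ℝ) + 1)) (by positivity)
    -- Averaging and passing to a maximal function do not lower the dual value, and put the whole
    -- maximizing sequence into one equicontinuous class.
    obtain ⟨w, hvw, hw⟩ := exists_maximal_subCost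
      (average_mem_subCost hsymm (u := fun i => u i) hu)
    refine ⟨w, hw, hlt.le.trans ?_⟩
    have hi : Integrable (fun y => (N : ℝ)⁻¹ * ∑ j, u j y) ρ :=
      (integrable_finsetSum _ fun j _ => (u j).integrable ρ).const_mul _
    have h1 := integral_mono hi (hintM w hw) hvw
    rw [integral_const_mul, integral_finsetSum _ fun j _ => (u j).integrable ρ,
      inv_mul_le_iff₀ hN] at h1
    exact h1
  choose v hv hvI using hstep
  obtain ⟨u, s, hs, hu⟩ := exists_subseq_tendsto v
    (fun n x => maximal_subCost_abs_le (hv n) hk0 hkM x) (fun ε hε => by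
      obtain ⟨δ, hδ, h⟩ := hmod ε hε
      exact ⟨δ, hδ, fun n => h _ (hv n)⟩)
  have hmeas : AEStronglyMeasurable u ρ :=
    aestronglyMeasurable_of_tendsto_ae atTop
      (fun n => (hcont _ (hv (s n))).aestronglyMeasurable) (Eventually.of_forall hu)
  have hlim : Tendsto (fun n => ∫ x, v (s n) x ∂ρ) atTop (𝓝 (∫ x, u x ∂ρ)) :=
    tendsto_integral_of_dominated_convergence (fun _ => Fintype.card (Fin N) * M)
      (fun n => (hcont _ (hv (s n))).aestronglyMeasurable) (integrable_const _)
      (fun n => Eventually.of_forall fun x => maximal_subCost_abs_le (hv (s n)) hk0 hkM x)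
      (Eventually.of_forall hu)
  refine ⟨u, fun x => ?_, ?_, ?_⟩
  · exact le_of_tendsto' (tendsto_finsetSum _ fun i _ => hu (x i)) fun n => (hv (s n)).prop x
  · refine Integrable.of_bound hmeas (Fintype.card (Fin N) * M) (Eventually.of_forall fun x => ?_)
    exact le_of_tendsto' (hu x).abs fun n => maximal_subCost_abs_le (hv (s n)) hk0 hkM x
  · have h1 : Tendsto (fun n => I - 1 / ((s n : ℝ) + 1)) atTop (𝓝 (I - 0)) :=
      (tendsto_one_div_add_atTop_nhds_zero_nat.comp hs.tendsto_atTop).const_sub I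
    rw [sub_zero] at h1
    exact le_of_tendsto_of_tendsto' h1 (hlim.const_mul _) fun n => hvI (s n)

/-! ### The repulsive profile and its truncated cost -/

variable {d N : ℕ} {φ : ℝ → ℝ} {α β : ℝ}

theorem IsRepulsive.pos (hφ : IsRepulsive φ) {t : ℝ} (ht : 0 < t) : 0 < φ t :=
  (hφ.nonneg (t + 1) (by linarith)).trans_lt
    (hφ.strictAntiOn ht (show (0 : ℝ) < t + 1 by linarith) (by linarith))

theorem IsRepulsive.anti (hφ : IsRepulsive φ) {s t : ℝ} (hs : 0 < s) (hst : s ≤ t) : φ t ≤ φ s :=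
  hφ.strictAntiOn.antitoneOn hs (hs.trans_le hst) hst

theorem IsRepulsive.exists_eq (hφ : IsRepulsive φ) (hβ : 0 < β) {y : ℝ} (hy : φ β ≤ y) :
    ∃ t ∈ Ioi (0 : ℝ), φ t = y := by
  obtain ⟨t, hyt, ht0, htβ⟩ := ((hφ.tendsto_zero.eventually_ge_atTop y).and
    (Ioc_mem_nhdsGT hβ)).exists
  obtain ⟨s, hs, rfl⟩ := intermediate_value_Icc' htβ
    (hφ.continuousOn.mono fun s hs => ht0.trans_le hs.1) ⟨hy, hyt⟩
  exact ⟨s, ht0.trans_le hs.1, rfl⟩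

theorem IsRepulsive.inverse_pos (hφ : IsRepulsive φ) (hβ : 0 < β) {y : ℝ} (hy : φ β ≤ y) :
    0 < inverse φ y :=
  Function.invFunOn_mem (hφ.exists_eq hβ hy)

theorem IsRepulsive.apply_inverse (hφ : IsRepulsive φ) (hβ : 0 < β) {y : ℝ} (hy : φ β ≤ y) :
    φ (inverse φ y) = y :=
  Function.invFunOn_eq (hφ.exists_eq hβ hy)

/-- Since the factor is at least 1, the argument of `inverse φ` in the theorem lies in the range of
`φ`. -/
theorem le_mul_of_one_lt (hN : 1 < N) {a : ℝ} (ha : 0 ≤ a) :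
    a ≤ (N : ℝ) ^ 2 * ((N : ℝ) - 1) / 2 * a := by
  have h : (2 : ℝ) ≤ N := by exact_mod_cast hN
  refine le_mul_of_one_le_left ha ?_
  nlinarith

/-- The truncated cost as a real-valued function. -/
def realCost (φ : ℝ → ℝ) (α : ℝ) (x : Fin N → Space d) : ℝ :=
  ∑ i : Fin N, ∑ j ∈ Finset.Ioi i, φ (max ‖x i - x j‖ α)

theorem truncate_eq (hφ : IsRepulsive φ) (hα : 0 < α) (t : ℝ) :
    truncate φ α t = ENNReal.ofReal (φ (max t α)) := by
  unfold truncate extend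
  split_ifs with ht
  · rcases le_total t α with h | h
    · rw [max_eq_right h, min_eq_right (ENNReal.ofReal_le_ofReal (hφ.anti ht h))]
    · rw [max_eq_left h, min_eq_left (ENNReal.ofReal_le_ofReal (hφ.anti hα h))]
  · rw [max_eq_right ((not_lt.1 ht).trans hα.le), min_eq_right le_top]

theorem pair_pos (hφ : IsRepulsive φ) (hα : 0 < α) (t : ℝ) : 0 < φ (max t α) :=
  hφ.pos (lt_max_of_lt_right hα)

theorem truncatedCost_eq (hφ : IsRepulsive φ) (hα : 0 < α) (x : Fin N → Space d) :
    truncatedCost φ α x = ENNReal.ofReal (realCost φ α x) := by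
  unfold truncatedCost pairCost realCost
  rw [ENNReal.ofReal_sum_of_nonneg fun i _ => Finset.sum_nonneg fun j _ => (pair_pos hφ hα _).le]
  refine Finset.sum_congr rfl fun i _ => ?_
  rw [ENNReal.ofReal_sum_of_nonneg fun j _ => (pair_pos hφ hα _).le]
  exact Finset.sum_congr rfl fun j _ => truncate_eq hφ hα _

theorem truncatedCost_le_cost (φ : ℝ → ℝ) (α : ℝ) (x : Fin N → Space d) :
    truncatedCost φ α x ≤ cost φ x := by
  unfold truncatedCost cost pairCost
  exact Finset.sum_le_sum fun _ _ => Finset.sum_le_sum fun _ _ => min_le_left _ _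

theorem cost_eq_of_separated (hφ : IsRepulsive φ) (hα : 0 < α) {x : Fin N → Space d}
    (hx : ∀ i j, i ≠ j → α ≤ ‖x i - x j‖) : cost φ x = truncatedCost φ α x := by
  unfold truncatedCost cost pairCost
  refine Finset.sum_congr rfl fun i _ => Finset.sum_congr rfl fun j hj => ?_
  have h := hx i j (Finset.mem_Ioi.1 hj).ne
  rw [truncate_eq hφ hα, max_eq_left h, extend, if_pos (hα.trans_le h)]

theorem realCost_nonneg (hφ : IsRepulsive φ) (hα : 0 < α) (x : Fin N → Space d) :
    0 ≤ realCost φ α x :=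
  Finset.sum_nonneg fun _ _ => Finset.sum_nonneg fun _ _ => (pair_pos hφ hα _).le

theorem sum_sum_Ioi_const (N : ℕ) (a : ℝ) :
    ∑ i : Fin N, ∑ _j ∈ Finset.Ioi i, a = N * (N - 1) / 2 * a := by
  induction N with
  | zero => simp
  | succ n ih =>
    rw [Fin.sum_univ_succ]
    simp only [Finset.sum_const, Fin.card_Ioi, nsmul_eq_mul] at ih ⊢
    have h : ∀ i : Fin n, n + 1 - 1 - (i.succ : ℕ) = n - 1 - i := fun i => by
      rw [Fin.val_succ]; omega
    simp_rw [h, ih]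
    push_cast
    simp
    ring

theorem realCost_le_of_forall {a : ℝ} {x : Fin N → Space d}
    (h : ∀ i j, i ≠ j → φ (max ‖x i - x j‖ α) ≤ a) : realCost φ α x ≤ N * (N - 1) / 2 * a := by
  rw [← sum_sum_Ioi_const]
  exact Finset.sum_le_sum fun i _ => Finset.sum_le_sum fun j hj => h i j (Finset.mem_Ioi.1 hj).ne

theorem realCost_le (hφ : IsRepulsive φ) (hα : 0 < α) (x : Fin N → Space d) :
    realCost φ α x ≤ N * (N - 1) / 2 * φ α :=
  realCost_le_of_forall fun _ _ _ => hφ.anti hα (le_max_right _ _)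

theorem realCost_le_of_separated (hφ : IsRepulsive φ) (hβ : 0 < β) {x : Fin N → Space d}
    (hx : ∀ i j, i ≠ j → β ≤ ‖x i - x j‖) : realCost φ α x ≤ N * (N - 1) / 2 * φ β :=
  realCost_le_of_forall fun i j hij => hφ.anti hβ ((hx i j hij).trans (le_max_left _ _))

theorem pair_le_realCost (hφ : IsRepulsive φ) (hα : 0 < α) (x : Fin N → Space d) {i j : Fin N}
    (hij : i ≠ j) : φ (max ‖x i - x j‖ α) ≤ realCost φ α x := by
  wlog h : i < j generalizing i j
  · rw [norm_sub_rev]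
    exact this hij.symm (lt_of_le_of_ne (not_lt.1 h) hij.symm)
  · refine (Finset.single_le_sum (f := fun j => φ (max ‖x i - x j‖ α))
      (fun _ _ => (pair_pos hφ hα _).le) (Finset.mem_Ioi.2 h)).trans ?_
    exact Finset.single_le_sum (f := fun i => ∑ j ∈ Finset.Ioi i, φ (max ‖x i - x j‖ α))
      (fun _ _ => Finset.sum_nonneg fun _ _ => (pair_pos hφ hα _).le) (Finset.mem_univ i)

theorem realCost_pos (hN : 1 < N) (hφ : IsRepulsive φ) (hα : 0 < α) (x : Fin N → Space d) :
    0 < realCost φ α x := by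
  have h : (⟨0, by omega⟩ : Fin N) ≠ ⟨1, hN⟩ := by simp
  exact (pair_pos hφ hα _).trans_le (pair_le_realCost hφ hα x h)

/-- Unlike the sum over $i<j$, the full double sum and the diagonal are visibly invariant under
permutations. -/
theorem two_mul_realCost (φ : ℝ → ℝ) (α : ℝ) (x : Fin N → Space d) :
    2 * realCost φ α x
      = ∑ i, ∑ j, φ (max ‖x i - x j‖ α) - ∑ i : Fin N, φ (max ‖x i - x i‖ α) := by
  have h := Finset.sum_sum_Ioi_add_eq_sum_sum_off_diag fun i j => φ (max ‖x i - x j‖ α)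
  have h1 : ∀ i : Fin N, ∑ j ∈ {i}ᶜ, φ (max ‖x j - x i‖ α)
      = ∑ j, φ (max ‖x i - x j‖ α) - φ (max ‖x i - x i‖ α) := fun i => by
    rw [eq_sub_iff_add_eq, ← Finset.sum_compl_add_sum {i}, Finset.sum_singleton]
    simp_rw [norm_sub_rev (x i)]
  simp_rw [h1] at h
  rw [← Finset.sum_sub_distrib, ← h, realCost, Finset.mul_sum]
  refine Finset.sum_congr rfl fun i _ => ?_
  rw [Finset.mul_sum]
  refine Finset.sum_congr rfl fun j _ => ?_
  rw [norm_sub_rev (x j)]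
  ring

theorem realCost_comp_perm (φ : ℝ → ℝ) (α : ℝ) (σ : Equiv.Perm (Fin N)) (x : Fin N → Space d) :
    realCost φ α (x ∘ σ) = realCost φ α x := by
  have h1 := two_mul_realCost φ α (x ∘ σ)
  have h2 := two_mul_realCost φ α x
  simp only [Function.comp_apply] at h1
  rw [Equiv.sum_comp σ fun i => φ (max ‖x i - x i‖ α),
    Equiv.sum_comp σ fun i => ∑ j, φ (max ‖x i - x (σ j)‖ α)] at h1
  have h3 : ∀ i, ∑ j, φ (max ‖x i - x (σ j)‖ α) = ∑ j, φ (max ‖x i - x j‖ α) := fun i =>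
    Equiv.sum_comp σ fun j => φ (max ‖x i - x j‖ α)
  simp_rw [h3] at h1
  linarith

/-- A monotone function bounded below has a limit at infinity; the absolute value makes it a limit
along the cocompact filter of the line. -/
theorem uniformContinuous_pair (hφ : IsRepulsive φ) (hα : 0 < α) :
    UniformContinuous fun t : ℝ => φ (max |t| α) := by
  have hanti : Antitone fun t : ℝ => φ (max t α) := fun s t hst =>
    hφ.anti (lt_max_of_lt_right hα) (max_le_max_right α hst)
  have hlim := tendsto_atTop_ciInf hanti ⟨0, by
    rintro _ ⟨t, rfl⟩
    exact (pair_pos hφ hα t).le⟩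
  refine Continuous.uniformContinuous_of_tendsto_cocompact ?_
    (hlim.comp (tendsto_norm_cocompact_atTop (E := ℝ)))
  exact hφ.continuousOn.comp_continuous (by fun_prop) fun t => lt_max_of_lt_right hα

theorem uniformContinuous_finsetSum {ι Y : Type*} [UniformSpace Y] (s : Finset ι) {f : ι → Y → ℝ}
    (h : ∀ i ∈ s, UniformContinuous (f i)) : UniformContinuous fun y => ∑ i ∈ s, f i y := by
  classical
  induction s using Finset.induction_on with
  | empty => simpa using uniformContinuous_const
  | insert a s ha ih =>
    simp_rw [Finset.sum_insert ha]
    exact (h a (Finset.mem_insert_self a s)).add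
      (ih fun i hi => h i (Finset.mem_insert_of_mem hi))

theorem uniformContinuous_realCost (hφ : IsRepulsive φ) (hα : 0 < α) :
    UniformContinuous (realCost φ α : (Fin N → Space d) → ℝ) := by
  refine uniformContinuous_finsetSum _ fun i _ => uniformContinuous_finsetSum _ fun j _ => ?_
  have h : UniformContinuous fun x : Fin N → Space d => ‖x i - x j‖ :=
    uniformContinuous_norm.comp
      ((Pi.uniformContinuous_proj _ i).sub (Pi.uniformContinuous_proj _ j))
  simpa only [Function.comp_def, abs_norm] using (uniformContinuous_pair hφ hα).comp h

/-! ### Separation of contact tuples -/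

/-- The threshold is the inverse of a number of balls: at most $N-1$ earlier tuples, with $N^2-N$
ordered pairs of distinct indices for each. -/
theorem mul_concentration_lt_one (hN : 1 < N) {μ : ℝ≥0∞} (hμ : μ < threshold N) {m : ℕ}
    (hm : m ≤ (N - 1) * (N * N - N)) : m * μ < 1 := by
  have h2 : (2 : ℝ) ≤ N := by exact_mod_cast hN
  have hpos : 0 < (N : ℝ) * ((N : ℝ) - 1) ^ 2 := by
    have : 0 < (N : ℝ) - 1 := by linarith
    positivity
  have hcast : (((N - 1) * (N * N - N) : ℕ) : ℝ) = (N : ℝ) * ((N : ℝ) - 1) ^ 2 := by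
    rw [Nat.cast_mul, Nat.cast_sub hN.le, Nat.cast_sub (Nat.le_mul_self N)]
    push_cast
    ring
  have hthr : threshold N = 1 / (((N - 1) * (N * N - N) : ℕ) : ℝ≥0∞) := by
    rw [threshold, ← hcast, ENNReal.ofReal_div_of_pos (by rw [hcast]; exact hpos),
      ENNReal.ofReal_one, ENNReal.ofReal_natCast]
  rw [hthr] at hμ
  refine lt_of_le_of_lt ?_ (ENNReal.mul_lt_of_lt_div' hμ)
  gcongr

/-- Given fewer than `N` tuples, almost every contact tuple has its coordinates far from the
coordinates of other index of the given ones. -/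
theorem exists_separated_tuple (hN : 1 < N) {ρ : Measure (Space d)}
    {P : Measure (Fin N → Space d)} [IsProbabilityMeasure P] (hP : ∀ i, P.map (fun x => x i) = ρ)
    (hβ : concentration ρ β < threshold N) {G : Set (Fin N → Space d)} (hG : ∀ᵐ x ∂P, x ∈ G)
    (T : ℕ → Fin N → Space d) {n : ℕ} (hn : n < N) :
    ∃ y ∈ G, ∀ m < n, ∀ i l, i ≠ l → β ≤ dist (T m i) (y l) := by
  set A : Set (Fin N → Space d) := ⋃ m ∈ Finset.range n,
    ⋃ p ∈ (Finset.univ : Finset (Fin N)).offDiag, {y | y p.2 ∈ Metric.ball (T m p.1) β} with hA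
  have hball : ∀ (l : Fin N) (z : Space d),
      P {y | y l ∈ Metric.ball z β} ≤ concentration ρ β := fun l z => by
    have h : P {y | y l ∈ Metric.ball z β} = ρ (Metric.ball z β) := by
      rw [← hP l, Measure.map_apply (measurable_pi_apply l) measurableSet_ball]
      rfl
    rw [h]
    exact le_iSup (fun z => ρ (Metric.ball z β)) z
  have hPA : P A < 1 := by
    refine lt_of_le_of_lt (b := (n * (N * N - N) : ℕ) * concentration ρ β) ?_
      (mul_concentration_lt_one hN hβ (Nat.mul_le_mul_right _ (by omega)))
    refine (measure_biUnion_finset_le _ _).trans ?_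
    refine (Finset.sum_le_sum fun m _ => (measure_biUnion_finset_le _ _).trans
      (Finset.sum_le_sum fun p _ => hball _ _)).trans ?_
    simp only [Finset.sum_const, Finset.offDiag_card, Finset.card_univ, Fintype.card_fin,
      Finset.card_range, nsmul_eq_mul]
    rw [Nat.cast_mul, mul_assoc]
  obtain ⟨y, hyG, hyA⟩ : ∃ y ∈ G, y ∉ A := by
    by_contra! h
    refine hPA.not_ge ?_
    rw [← measure_univ (μ := P)]
    refine measure_mono_ae ?_
    filter_upwards [hG] with y hy _ using h y hy
  refine ⟨y, hyG, fun m hm i l hil => ?_⟩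
  by_contra! hlt
  refine hyA ?_
  simp only [hA, mem_iUnion]
  refine ⟨m, Finset.mem_range.2 hm, (i, l), by simpa using hil, ?_⟩
  rwa [mem_ofPred_eq, Metric.mem_ball, dist_comm]

/-- Tuples are added one at a time, starting from `x₀`. Equal indices need no separation, as an
exchanged tuple never uses an index twice. -/
theorem exists_separated_tuples (hN : 1 < N) {ρ : Measure (Space d)}
    {P : Measure (Fin N → Space d)} [IsProbabilityMeasure P] (hP : ∀ i, P.map (fun x => x i) = ρ)
    (hβ : concentration ρ β < threshold N) {G : Set (Fin N → Space d)} (hG : ∀ᵐ x ∂P, x ∈ G)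
    {x₀ : Fin N → Space d} (hx₀ : x₀ ∈ G) :
    ∃ T : Fin N → Fin N → Space d, T ⟨0, by omega⟩ = x₀ ∧ (∀ n, T n ∈ G) ∧
      ∀ m n, m ≠ n → ∀ i l, i ≠ l → β ≤ ‖T m i - T n l‖ := by
  have key : ∀ n < N, ∃ T : ℕ → Fin N → Space d, T 0 = x₀ ∧ (∀ m ≤ n, T m ∈ G) ∧
      ∀ m m', m < m' → m' ≤ n → ∀ i l, i ≠ l → β ≤ dist (T m i) (T m' l) := by
    intro n
    induction n with
    | zero => exact fun _ => ⟨fun _ => x₀, rfl, fun _ _ => hx₀, fun m m' h h' => by omega⟩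
    | succ n ih =>
      intro hn
      obtain ⟨T, hT0, hTG, hT⟩ := ih (by omega)
      obtain ⟨y, hyG, hy⟩ := exists_separated_tuple hN hP hβ hG T hn
      refine ⟨Function.update T (n + 1) y, ?_, fun m hm => ?_, fun m m' hmm hm' i l hil => ?_⟩
      · rw [Function.update_of_ne (by omega), hT0]
      · rcases eq_or_ne m (n + 1) with rfl | h
        · rwa [Function.update_self]
        · rw [Function.update_of_ne h]
          exact hTG m (by omega)
      · rw [Function.update_of_ne (a := m) (by omega)]
        rcases eq_or_ne m' (n + 1) with rfl | h
        · rw [Function.update_self]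
          exact hy m hmm i l hil
        · rw [Function.update_of_ne h]
          exact hT m m' hmm (by omega) i l hil
  obtain ⟨T, hT0, hTG, hT⟩ := key (N - 1) (by omega)
  refine ⟨fun n => T n, hT0, fun n => hTG n (by omega), fun m n hmn i l hil => ?_⟩
  rw [← dist_eq_norm]
  rcases lt_or_gt_of_ne (Fin.val_ne_of_ne hmn) with h | h
  · exact hT m n h (by omega) i l hil
  · rw [dist_comm]
    exact hT n m h (by omega) l i hil.symm

/-- Contact tuples of an optimal potential for the truncated cost are separated. -/
theorem separated_of_contact (hN : 1 < N) (hφ : IsRepulsive φ) (hα : 0 < α) (hβ : 0 < β)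
    (hαβ : (N : ℝ) ^ 2 * ((N : ℝ) - 1) / 2 * φ β ≤ φ α) {ρ : Measure (Space d)}
    {P : Measure (Fin N → Space d)} [IsProbabilityMeasure P] (hP : ∀ i, P.map (fun x => x i) = ρ)
    (hρ : concentration ρ β < threshold N) {u : Space d → ℝ}
    (hu : u ∈ subCost (realCost φ α : (Fin N → Space d) → ℝ))
    (hcontact : ∀ᵐ x ∂P, ∑ i, u (x i) = realCost φ α x) {x : Fin N → Space d}
    (hx : ∑ i, u (x i) = realCost φ α x) (i j : Fin N) (hij : i ≠ j) : α ≤ ‖x i - x j‖ := by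
  have : NeZero N := ⟨by omega⟩
  by_contra! hlt
  obtain ⟨T, hT0, hTG, hT⟩ := exists_separated_tuples hN hP hρ
    (G := {x | ∑ i, u (x i) = realCost φ α x}) hcontact hx
  -- The exchanged tuple takes its coordinate `i` from the tuple `i + m`, so distinct coordinates
  -- come from distinct tuples.
  have hS : ∀ m : Fin N, realCost φ α (fun i => T (i + m) i) ≤ N * (N - 1) / 2 * φ β := fun m =>
    realCost_le_of_separated hφ hβ fun i l hil =>
      hT (i + m) (l + m) (fun h => hil (add_right_cancel h)) i l hil
  have hsum : ∑ n, realCost φ α (T n) = ∑ m, ∑ i, u (T (i + m) i) := by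
    rw [Finset.sum_comm]
    calc ∑ n, realCost φ α (T n) = ∑ n, ∑ i, u (T n i) :=
          Finset.sum_congr rfl fun n _ => (hTG n).symm
      _ = ∑ i, ∑ n, u (T n i) := Finset.sum_comm
      _ = _ := Finset.sum_congr rfl fun i _ =>
          (Equiv.sum_comp (Equiv.addLeft i) fun n => u (T n i)).symm
  have hle : ∑ n, realCost φ α (T n) ≤ N * (N * (N - 1) / 2 * φ β) := by
    rw [hsum]
    refine (Finset.sum_le_sum fun m _ => (hu fun i => T (i + m) i).trans (hS m)).trans ?_
    simp
  have hα' : φ α ≤ realCost φ α (T ⟨0, by omega⟩) := by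
    rw [hT0]
    have h := pair_le_realCost hφ hα x hij
    rwa [max_eq_right hlt.le] at h
  -- Strictness comes from the positive cost of a second tuple; it permits equality in the condition
  -- on `α`.
  have hgt : realCost φ α (T ⟨0, by omega⟩) < ∑ n, realCost φ α (T n) :=
    Finset.single_lt_sum (f := fun n => realCost φ α (T n)) (i := ⟨0, by omega⟩) (j := ⟨1, hN⟩)
      (by simp) (Finset.mem_univ _) (Finset.mem_univ _) (realCost_pos hN hφ hα _)
      fun _ _ _ => realCost_nonneg hφ hα _
  have hring : (N : ℝ) * (N * (N - 1) / 2 * φ β) = (N : ℝ) ^ 2 * ((N : ℝ) - 1) / 2 * φ β := by ring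
  linarith

/-! ### Weak duality and passage to the full cost -/

theorem coe_le_coe_ennreal_iff {a : ℝ} {b : ℝ≥0∞} :
    (a : EReal) ≤ (b : EReal) ↔ ENNReal.ofReal a ≤ b := by
  rw [← EReal.coe_ennreal_le_coe_ennreal_iff, EReal.coe_ennreal_ofReal,
    EReal.coe_strictMono.monotone.map_max, max_le_iff, EReal.coe_zero]
  exact ⟨fun h => ⟨h, EReal.coe_ennreal_nonneg b⟩, fun h => h.1⟩

section Marginals

variable {X : Type*} [MeasurableSpace X] {ρ : Measure X} {P : Measure (Fin N → X)}

theorem integrable_coord (hP : ∀ i, P.map (fun x => x i) = ρ) {u : X → ℝ} (hu : Integrable u ρ)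
    (i : Fin N) : Integrable (fun x : Fin N → X => u (x i)) P :=
  (hP i ▸ hu).comp_measurable (measurable_pi_apply i)

theorem integral_sum_coord (hP : ∀ i, P.map (fun x => x i) = ρ) {u : X → ℝ}
    (hu : Integrable u ρ) : ∫ x, ∑ i, u (x i) ∂P = N * ∫ x, u x ∂ρ := by
  rw [integral_finsetSum _ fun i _ => integrable_coord hP hu i]
  have h : ∀ i, ∫ x : Fin N → X, u (x i) ∂P = ∫ x, u x ∂ρ := fun i => by
    rw [← integral_map (φ := fun x : Fin N → X => x i) (measurable_pi_apply i).aemeasurable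
      (by rw [hP i]; exact hu.aestronglyMeasurable), hP i]
  simp [h]

end Marginals

theorem ofReal_integral_le_lintegral {Y : Type*} [MeasurableSpace Y] {μ : Measure Y} {f : Y → ℝ}
    (hf : Integrable f μ) : ENNReal.ofReal (∫ y, f y ∂μ) ≤ ∫⁻ y, ENNReal.ofReal (f y) ∂μ := by
  rw [integral_eq_lintegral_pos_part_sub_lintegral_neg_part hf]
  exact (ENNReal.ofReal_le_ofReal (sub_le_self _ ENNReal.toReal_nonneg)).trans
    ENNReal.ofReal_toReal_le

/-- Weak duality. -/
theorem dualValue_le_lintegral {k : (Fin N → Space d) → ℝ≥0∞} {ρ : Measure (Space d)}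
    {u : Space d → ℝ} (hu : u ∈ dualAdmissible k ρ) {P : Measure (Fin N → Space d)}
    (hP : P ∈ plans N ρ) : ((dualValue N ρ u : ℝ) : EReal) ≤ ((∫⁻ x, k x ∂P : ℝ≥0∞) : EReal) := by
  rw [coe_le_coe_ennreal_iff, dualValue, ← integral_sum_coord hP.2 hu.1]
  refine (ofReal_integral_le_lintegral
    (integrable_finsetSum _ fun i _ => integrable_coord hP.2 hu.1 i)).trans ?_
  exact lintegral_mono fun x => coe_le_coe_ennreal_iff.1 (hu.2 x)

theorem dualAdmissible_mono {k k' : (Fin N → Space d) → ℝ≥0∞} {ρ : Measure (Space d)}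
    (h : ∀ x, k x ≤ k' x) : dualAdmissible k ρ ⊆ dualAdmissible k' ρ := fun _ hu =>
  ⟨hu.1, fun x => (hu.2 x).trans (EReal.coe_ennreal_le_coe_ennreal_iff.2 (h x))⟩

/-- A plan and a potential for the truncated cost with the same value for the full cost. -/
theorem exists_plan_potential_cost (hN : 1 < N) (hφ : IsRepulsive φ) (hα : 0 < α) (hβ : 0 < β)
    (hαβ : (N : ℝ) ^ 2 * ((N : ℝ) - 1) / 2 * φ β ≤ φ α) {ρ : Measure (Space d)}
    [IsProbabilityMeasure ρ] (hρ : concentration ρ β < threshold N) :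
    ∃ P ∈ plans N ρ, ∃ u ∈ dualAdmissible (N := N) (truncatedCost φ α) ρ,
      ((∫⁻ x, cost φ x ∂P : ℝ≥0∞) : EReal) = ((dualValue N ρ u : ℝ) : EReal) := by
  have : NeZero N := ⟨by omega⟩
  obtain ⟨P, hP, hPm, u, hu, hui, hle⟩ := exists_plan_potential ρ
    (uniformContinuous_realCost (d := d) (N := N) hφ hα) (realCost_nonneg hφ hα)
    (realCost_le hφ hα) (realCost_comp_perm φ α)
  have hkint : Integrable (realCost φ α : (Fin N → Space d) → ℝ) P :=
    Integrable.of_bound (uniformContinuous_realCost hφ hα).continuous.aestronglyMeasurable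
      (N * (N - 1) / 2 * φ α) (Eventually.of_forall fun x => by
        rw [Real.norm_of_nonneg (realCost_nonneg hφ hα x)]
        exact realCost_le hφ hα x)
  have huint : Integrable (fun x : Fin N → Space d => ∑ i, u (x i)) P :=
    integrable_finsetSum _ fun i _ => integrable_coord hPm hui i
  have hsum := integral_sum_coord hPm hui
  have hval : ∫ x, realCost φ α x ∂P = dualValue N ρ u :=
    le_antisymm hle (by rw [dualValue, ← hsum]; exact integral_mono huint hkint hu)
  have hcontact : ∀ᵐ x ∂P, ∑ i, u (x i) = realCost φ α x := by
    -- The slack in the constraint is nonnegative with integral zero.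
    have h0 : ∫ x, (realCost φ α x - ∑ i, u (x i)) ∂P = 0 := by
      rw [integral_sub hkint huint, hval, hsum, dualValue, sub_self]
    have h := (integral_eq_zero_iff_of_nonneg (fun x => sub_nonneg.2 (hu x))
      (hkint.sub huint)).1 h0
    filter_upwards [h] with x hx
    exact (sub_eq_zero.1 hx).symm
  have hcost : ∀ᵐ x ∂P, cost φ x = ENNReal.ofReal (realCost φ α x) := by
    filter_upwards [hcontact] with x hx
    rw [← truncatedCost_eq hφ hα]
    exact cost_eq_of_separated hφ hα
      (separated_of_contact hN hφ hα hβ hαβ hPm hρ hu hcontact hx)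
  refine ⟨P, ⟨hP, hPm⟩, u, ⟨hui, fun x => ?_⟩, ?_⟩
  · rw [coe_le_coe_ennreal_iff, truncatedCost_eq hφ hα]
    exact ENNReal.ofReal_le_ofReal (hu x)
  · rw [lintegral_congr_ae hcost, ← ofReal_integral_eq_lintegral_ofReal hkint
      (Eventually.of_forall (realCost_nonneg hφ hα)), EReal.coe_ennreal_ofReal, hval,
      max_eq_left]
    rw [← hval]
    exact integral_nonneg (realCost_nonneg hφ hα)

end RepulsiveOT

end

theorem mainTheorem2 (d N : ℕ) (hN : 1 < N) (φ : ℝ → ℝ) (hφ : IsRepulsive φ)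
    (ρ : Measure (Space d)) [IsProbabilityMeasure ρ] (hA : SmallConcentration N ρ) :
    -- `C(ρ)` is a minimum
    (∃ P ∈ plans N ρ, ∫⁻ x, cost φ x ∂P = transportCost (N := N) (cost φ) ρ) ∧
    -- `C(ρ)` is the maximum of the dual problem
    IsGreatest ((fun u => ((dualValue N ρ u : ℝ) : EReal)) '' dualAdmissible (N := N) (cost φ) ρ)
      ((transportCost (N := N) (cost φ) ρ : ℝ≥0∞) : EReal) ∧
    -- potentials for the truncated cost are potentials for the cost
    ∀ β : ℝ, 0 < β → concentration ρ β < threshold N →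
      ∀ α : ℝ, 0 < α → α ≤ inverse φ ((N : ℝ) ^ 2 * ((N : ℝ) - 1) / 2 * φ β) →
        ∀ u : Space d → ℝ, IsKantorovichPotential (N := N) (truncatedCost φ α) ρ u →
          IsKantorovichPotential (N := N) (cost φ) ρ u := by
  have hinv : ∀ β : ℝ, 0 < β →
      φ β ≤ (N : ℝ) ^ 2 * ((N : ℝ) - 1) / 2 * φ β := fun β hβ =>
    le_mul_of_one_lt hN (hφ.nonneg β hβ)
  obtain ⟨l, hl, hlt⟩ := hA
  obtain ⟨β, hρ, hβ⟩ := ((hl.eventually_lt_const hlt).and self_mem_nhdsWithin).exists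
  -- Here `α` is the largest allowed value, with $\phi(\alpha)=\frac{N^2(N-1)}2\phi(\beta)$.
  obtain ⟨P, hP, u, hu, hPu⟩ := exists_plan_potential_cost hN hφ
    (hφ.inverse_pos hβ (hinv β hβ)) hβ (hφ.apply_inverse hβ (hinv β hβ)).ge hρ
  have hu' := dualAdmissible_mono (truncatedCost_le_cost φ _) hu
  have hC : ∫⁻ x, cost φ x ∂P = transportCost (N := N) (cost φ) ρ := by
    refine le_antisymm (le_iInf₂ fun Q hQ => ?_) (iInf₂_le P hP)
    rw [← EReal.coe_ennreal_le_coe_ennreal_iff, hPu]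
    exact dualValue_le_lintegral hu' hQ
  refine ⟨⟨P, hP, hC⟩, ⟨⟨u, hu', ?_⟩, ?_⟩, ?_⟩
  · rw [← hC, hPu]
  · rintro _ ⟨v, hv, rfl⟩
    rw [← hC]
    exact dualValue_le_lintegral hv hP
  · intro β hβ hρ α hα hαβ w hw
    have hle : (N : ℝ) ^ 2 * ((N : ℝ) - 1) / 2 * φ β ≤ φ α := by
      rw [← hφ.apply_inverse hβ (hinv β hβ)]
      exact hφ.anti hα hαβ
    -- The potential `u` links the two problems: a competitor `v` for $c$ has value at most $\int
    -- c\,dP$, which is the value of `u`, and `w` does at least as well as `u` for $c_\alpha$.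
    obtain ⟨P, hP, u, hu, hPu⟩ := exists_plan_potential_cost hN hφ hα hβ hle hρ
    refine ⟨dualAdmissible_mono (truncatedCost_le_cost φ α) hw.1, fun v hv => ?_⟩
    have h := dualValue_le_lintegral hv hP
    rw [hPu, EReal.coe_le_coe_iff] at h
    exact h.trans (hw.2 hu)
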